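/- All graphs are finite and simple. Write $H \le G$ if $H$ is isomorphic to an induced subgraph of $G$. A graph $G$ is *$P_4$-sparse* if every set of at most five vertices of $G$ induces at most one $P_4$ (i.e. contains at most one four-vertex subset that induces a path on four vertices). **Corollary.** The class of $P_4$-sparse graphs is well-quasi-ordered by the induced subgraph relation: for every infinite sequence $G_0, G_1, G_2, \dots$ of $P_4$-sparse graphs there are $i < j$ with $G_i \le G_j$. Equivalently, every hereditary property on $P_4$-sparse graphs admits a finite forbidden induced subgraph characterization: let $\mathcal{P}$ be a property of $P_4$-sparse graphs that is hereditary (if $G$ has $\mathcal{P}$ and $H \le G$, then $H$ has $\mathcal{P}$), and call a $P_4$-sparse graph $G$ a *minimal $\mathcal{P}$-obstruction* if $G$ does not have $\mathcal{P}$ but every proper induced subgraph of $G$ has $\mathcal{P}$. Then, up to isomorphism, there are only finitely many $P_4$-sparse minimal $\mathcal{P}$-obstructions, and a $P_4$-sparse graph has $\mathcal{P}$ if and only if it contains none of them as an induced subgraph. -/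

import Mathlib

universe u

/-- A finite simple graph (with vertices in an arbitrary universe); the null graph is allowed. -/
structure FiniteGraph : Type (u + 1) where
  /-- The vertex set. -/
  V : Type u
  finite : Finite V
  /-- The adjacency structure. -/
  graph : SimpleGraph V

namespace FiniteGraph

/-- `H.IndLE G`: `H` is (isomorphic to) an induced subgraph of `G`. -/
def IndLE (H G : FiniteGraph.{u}) : Prop := H.graph.IsIndContained G.graph

/-- `G` and `H` are isomorphic. -/
def IsIso (G H : FiniteGraph.{u}) : Prop := Nonempty (G.graph ≃g H.graph)

/-- The subgraph of `G` induced by a vertex set `s`. -/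
def induce (G : FiniteGraph.{u}) (s : Set G.V) : FiniteGraph.{u} where
  V := s
  finite := haveI := G.finite; Subtype.finite
  graph := G.graph.induce s

/-- The vertex set `X` induces a `P₄`, the path on four vertices. -/
def InducesP4 (G : FiniteGraph.{u}) (X : Finset G.V) : Prop :=
  Nonempty (SimpleGraph.pathGraph 4 ≃g G.graph.induce (X : Set G.V))

/-- `G` is `P₄`-sparse: any set `W` of at most five vertices induces at most one `P₄`, that is,
at most one subset of `W` induces a `P₄`. -/
def IsP4Sparse (G : FiniteGraph.{u}) : Prop :=
  ∀ W : Finset G.V, W.card ≤ 5 →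
    ∀ X Y : Finset G.V, X ⊆ W → Y ⊆ W → G.InducesP4 X → G.InducesP4 Y → X = Y

/-- `P` is a hereditary property on the class `C`: within `C`, it is closed under taking induced
subgraphs (and hence invariant under isomorphism). Nothing is asked of `P` outside `C`. -/
def IsHereditaryOn (C P : FiniteGraph.{u} → Prop) : Prop :=
  ∀ G H : FiniteGraph.{u}, C G → C H → H.IndLE G → P G → P H

/-- `G` is a minimal `P`-obstruction: `G` does not have the property `P`, but every proper induced
subgraph of `G` has it. -/
def IsMinimalObstruction (P : FiniteGraph.{u} → Prop) (G : FiniteGraph.{u}) : Prop :=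
  ¬ P G ∧ ∀ s : Set G.V, s ≠ Set.univ → P (G.induce s)

end FiniteGraph

/-!
The proof has two ingredients: a structure theorem for `P₄`-sparse graphs, and a minimal bad sequence
argument based on it.

**Structure.** By Jamison and Olariu, a `P₄`-sparse graph `G` on at least two vertices is, up to
complementation, disconnected or a thin spider (`SimpleGraph.P4Uniform.decomposes`). Sparseness is used
in the form that a vertex outside an induced path `a, b, c, d` sees none, all, or exactly the inner
vertices of it (`P4Uniform`); this form is invariant under complementation. The proof is by induction
on the number of vertices. If `G` contains a `P₄`, take a thin body (a matched stable set and clique)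
of maximal size in `G` or its complement. Every other vertex sees none of it, all of it, or exactly
its clique, and by maximality the body together with the vertices of the last kind is a module. If
this module is all of `G`, then `G` is a spider. Otherwise shrink the module to one vertex `b`: the
smaller graph decomposes, and since `b` stands for several twins it is on no `P₄`, so the
decomposition extends to `G` (`lift_decomposes`). The `P₄`-free case is the classical theorem on
cographs (`decomposes_of_p4Free`).

**Well-quasi-ordering.** In each case `G` is determined by a finite amount of data, a number of
legs, and two smaller induced subgraphs (the sides of a partition, or twice the head of a spider),
monotonically in these data (`CoDecomposesInto.isIndContained`). In a minimal bad sequence the proper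
induced subgraphs of the terms are well-quasi-ordered, hence so are these data by Dickson's lemma,
a contradiction.

The minimal obstructions of a hereditary property are pairwise incomparable up to isomorphism, so
there are finitely many isomorphism classes of them, and a graph of minimal size without the property
inside a given graph is one of them.
-/

/-! ### Induced paths and spiders -/

namespace SimpleGraph

variable {V : Type*} {G : SimpleGraph V}

/-- The vertices `a, b, c, d` induce a path on four vertices, in this order. Distinctness of the
four vertices is a consequence. -/
def IsInducedP4 (G : SimpleGraph V) (a b c d : V) : Prop :=
  G.Adj a b ∧ G.Adj b c ∧ G.Adj c d ∧ ¬ G.Adj a c ∧ ¬ G.Adj b d ∧ ¬ G.Adj a d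

/-- A vertex outside an induced path `a, b, c, d` is adjacent to none of its vertices, to all of
them, or to exactly the two inner ones. This is the local form of `P₄`-sparseness used throughout:
any other adjacency pattern creates a second `P₄` on the same five vertices. -/
def P4Uniform (G : SimpleGraph V) : Prop :=
  ∀ a b c d x, G.IsInducedP4 a b c d → x ≠ a → x ≠ b → x ≠ c → x ≠ d →
    (G.Adj x a ↔ G.Adj x d) ∧ (G.Adj x b ↔ G.Adj x c) ∧ (G.Adj x a → G.Adj x b)

/-- `s` and `κ` enumerate the legs and the body of a thin spider without head: the `s i` are
pairwise nonadjacent, the `κ i` pairwise adjacent, and `s i` is adjacent to `κ i` only. -/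
def IsThinBody (G : SimpleGraph V) {k : ℕ} (s κ : Fin k → V) : Prop :=
  (∀ i j, ¬ G.Adj (s i) (s j)) ∧ (∀ i j, i ≠ j → G.Adj (κ i) (κ j)) ∧
    ∀ i j, G.Adj (s i) (κ j) ↔ i = j

/-- `G` is a thin spider: every vertex outside a thin body (the head) is adjacent to the whole
clique `κ` and to no leg. The complements of thin spiders are the thick spiders. -/
def IsThinSpider (G : SimpleGraph V) : Prop :=
  ∃ k, 2 ≤ k ∧ ∃ s κ : Fin k → V, G.IsThinBody s κ ∧
    ∀ v, (∀ i, v ≠ s i) → (∀ i, v ≠ κ i) → ∀ i, ¬ G.Adj v (s i) ∧ G.Adj v (κ i)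

/-- The vertex set has a partition into two nonempty parts without edges between them. -/
def Splits (G : SimpleGraph V) : Prop :=
  ∃ U : Set V, U.Nonempty ∧ Uᶜ.Nonempty ∧ ∀ u ∈ U, ∀ w ∉ U, ¬ G.Adj u w

/-- `G` or its complement is disconnected or a thin spider. -/
def Decomposes (G : SimpleGraph V) : Prop :=
  (G.Splits ∨ G.IsThinSpider) ∨ (Gᶜ.Splits ∨ Gᶜ.IsThinSpider)

lemma Decomposes.of_compl (h : Gᶜ.Decomposes) : G.Decomposes := by
  unfold Decomposes at *
  rw [compl_compl] at h
  exact h.symm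

lemma IsInducedP4.ne {a b c d : V} (h : G.IsInducedP4 a b c d) :
    a ≠ b ∧ a ≠ c ∧ a ≠ d ∧ b ≠ c ∧ b ≠ d ∧ c ≠ d := by
  obtain ⟨h1, h2, h3, h4, h5, h6⟩ := h
  refine ⟨h1.ne, ?_, ?_, h2.ne, ?_, h3.ne⟩
  · rintro rfl; exact h6 h3
  · rintro rfl; exact h4 h3.symm
  · rintro rfl; exact h6 h1

lemma IsInducedP4.reverse {a b c d : V} (h : G.IsInducedP4 a b c d) : G.IsInducedP4 d c b a :=
  ⟨h.2.2.1.symm, h.2.1.symm, h.1.symm, fun e => h.2.2.2.2.1 e.symm, fun e => h.2.2.2.1 e.symm,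
    fun e => h.2.2.2.2.2 e.symm⟩

lemma isInducedP4_compl {a b c d : V} (h : Gᶜ.IsInducedP4 a b c d) : G.IsInducedP4 b d a c := by
  have hn := h.ne
  obtain ⟨h1, h2, h3, h4, h5, h6⟩ := h
  simp only [compl_adj] at *
  simp only [IsInducedP4]
  grind [G.adj_comm]

lemma P4Uniform.compl (h : G.P4Uniform) : Gᶜ.P4Uniform := by
  intro a b c d x hp ha hb hc hd
  have := h b d a c x (isInducedP4_compl hp) hb hd ha hc
  simp only [compl_adj]
  grind

lemma P4Uniform.induce (h : G.P4Uniform) (W : Set V) : (G.induce W).P4Uniform := by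
  intro a b c d x hp ha hb hc hd
  exact h a b c d x hp (by simpa [Subtype.ext_iff] using ha) (by simpa [Subtype.ext_iff] using hb)
    (by simpa [Subtype.ext_iff] using hc) (by simpa [Subtype.ext_iff] using hd)

lemma IsThinBody.isInducedP4 {k : ℕ} {s κ : Fin k → V} (h : G.IsThinBody s κ) {i j : Fin k}
    (hij : i ≠ j) : G.IsInducedP4 (s i) (κ i) (κ j) (s j) := by
  obtain ⟨h1, h2, h3⟩ := h
  refine ⟨(h3 i i).2 rfl, h2 i j hij, ((h3 j j).2 rfl).symm, ?_, ?_, h1 i j⟩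
  · rw [h3]; exact hij
  · rw [adj_comm, h3]; exact hij.symm

lemma IsThinBody.injective_body {k : ℕ} {s κ : Fin k → V} (h : G.IsThinBody s κ) :
    Function.Injective κ := by
  intro i j hij
  by_contra hne
  exact (h.2.1 i j hne).ne hij

lemma IsThinBody.injective_legs {k : ℕ} {s κ : Fin k → V} (h : G.IsThinBody s κ) :
    Function.Injective s := by
  intro i j hij
  have := (h.2.2 i i).2 rfl
  rw [hij, h.2.2] at this
  exact this.symm

lemma IsThinBody.leg_ne_body {k : ℕ} {s κ : Fin k → V} (h : G.IsThinBody s κ) (i j : Fin k) :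
    s i ≠ κ j := by
  intro he
  by_cases hij : i = j
  · subst hij
    exact ((h.2.2 i i).2 rfl).ne he
  · have := (h.2.2 j j).2 rfl
    rw [← he] at this
    exact h.1 _ _ this

/-- All pairs of legs give a `P₄`, so a vertex outside a thin body with at least two legs sees all
legs alike and all body vertices alike. -/
lemma IsThinBody.uniform (hG : G.P4Uniform) {k : ℕ} (hk : 2 ≤ k) {s κ : Fin k → V}
    (h : G.IsThinBody s κ) {x : V} (hs : ∀ i, x ≠ s i) (hκ : ∀ i, x ≠ κ i) (i j : Fin k) :
    (G.Adj x (s i) ↔ G.Adj x (s j)) ∧ (G.Adj x (κ i) ↔ G.Adj x (κ j)) ∧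
      (G.Adj x (s i) → G.Adj x (κ j)) := by
  have key : ∀ i j, i ≠ j → (G.Adj x (s i) ↔ G.Adj x (s j)) ∧
      (G.Adj x (κ i) ↔ G.Adj x (κ j)) ∧ (G.Adj x (s i) → G.Adj x (κ i)) := fun i j hij =>
    hG _ _ _ _ x (h.isInducedP4 hij) (hs i) (hκ i) (hκ j) (hs j)
  by_cases hij : i = j
  · subst hij
    have : Nontrivial (Fin k) := Fin.nontrivial_iff_two_le.2 hk
    obtain ⟨j, hj⟩ := exists_ne i
    exact ⟨Iff.rfl, Iff.rfl, (key i j hj.symm).2.2⟩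
  · obtain ⟨h1, h2, h3⟩ := key i j hij
    exact ⟨h1, h2, fun h => h2.1 (h3 h)⟩

/-! ### Modules -/

/-- If `b ≠ b'` lie in a module `M`, then `b` is on no `P₄` of the quotient by `M`, since `b'` could
replace it. Hence a decomposition of the graph obtained by shrinking `M` to `b` never uses `b`
in the body of a spider, and extends to all of `G`. -/
lemma lift_decomposition (hG : G.P4Uniform) {M : Set V}
    (hM : ∀ x ∉ M, ∀ m ∈ M, ∀ m' ∈ M, G.Adj x m ↔ G.Adj x m') {b b' : V} (hb : b ∈ M)
    (hb' : b' ∈ M) (hne : b' ≠ b)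
    (h : (G.induce (insert b Mᶜ)).Splits ∨ (G.induce (insert b Mᶜ)).IsThinSpider) :
    G.Splits ∨ G.IsThinSpider := by
  classical
  -- The retraction shrinking `M` to `b`.
  let ρ : V → (insert b Mᶜ : Set V) := fun v =>
    if hv : v ∈ M then ⟨b, Set.mem_insert _ _⟩ else ⟨v, Set.mem_insert_of_mem _ hv⟩
  have hρM : ∀ v ∈ M, ((ρ v : (insert b Mᶜ : Set V)) : V) = b := fun v hv => by simp [ρ, hv]
  have hρN : ∀ v ∉ M, ((ρ v : (insert b Mᶜ : Set V)) : V) = v := fun v hv => by simp [ρ, hv]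
  have hρid : ∀ v : (insert b Mᶜ : Set V), ρ v = v := by
    rintro ⟨v, rfl | hv⟩
    · exact Subtype.ext (hρM _ hb)
    · exact Subtype.ext (hρN _ hv)
  have hadj : ∀ u w, ρ u ≠ ρ w → (G.Adj u w ↔ G.Adj (ρ u) (ρ w)) := by
    intro u w huw
    rw [Ne, Subtype.ext_iff] at huw
    by_cases hu : u ∈ M <;> by_cases hw : w ∈ M
    · rw [hρM _ hu, hρM _ hw] at huw; exact absurd rfl huw
    · rw [hρM _ hu, hρN _ hw, adj_comm, hM w hw u hu b hb, adj_comm]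
    · rw [hρN _ hu, hρM _ hw, hM u hu w hw b hb]
    · rw [hρN _ hu, hρN _ hw]
  rcases h with ⟨U, ⟨u, hu⟩, ⟨w, hw⟩, hU⟩ | ⟨k, hk, s, κ, hB, hR⟩
  · refine Or.inl ⟨ρ ⁻¹' U, ⟨u, by simpa [hρid] using hu⟩, ⟨w, by simpa [hρid] using hw⟩, ?_⟩
    intro x hx y hy hxy
    have hne : ρ x ≠ ρ y := fun he => hy (by rw [Set.mem_preimage, ← he]; exact hx)
    exact hU _ hx _ hy ((hadj x y hne).1 hxy)
  · have hB' : G.IsThinBody (fun i => (s i : V)) (fun i => (κ i : V)) := hB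
    have hmem : ∀ v : (insert b Mᶜ : Set V), (v : V) ≠ b → (v : V) ∉ M := by
      rintro ⟨v, rfl | hv⟩ h
      · exact absurd rfl h
      · exact hv
    have hbM : ∀ v : (insert b Mᶜ : Set V), (v : V) ≠ b' := by
      rintro ⟨v, rfl | hv⟩ h
      · exact hne h.symm
      · exact hv ((show v = b' from h) ▸ hb')
    have : Nontrivial (Fin k) := Fin.nontrivial_iff_two_le.2 hk
    -- A vertex of a `P₄` has no twin outside that path, but `b'` would be a twin of `b`.
    have hnb : ∀ i, (s i : V) ≠ b ∧ (κ i : V) ≠ b := by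
      intro i
      obtain ⟨j, hj⟩ := exists_ne i
      have hp := hB'.isInducedP4 hj.symm
      have hn := hp.ne
      have := hG _ _ _ _ b' hp (hbM _).symm (hbM _).symm (hbM _).symm (hbM _).symm
      have h1 := fun v hv => hM _ (hmem v hv) b hb b' hb'
      have e1 := h1 (s i)
      have e2 := h1 (κ i)
      have e3 := h1 (s j)
      have e4 := h1 (κ j)
      obtain ⟨p1, p2, p3, p4, p5, p6⟩ := hp
      constructor
      · intro he; grind [G.adj_comm]
      · intro he; grind [G.adj_comm]
    refine Or.inr ⟨k, hk, _, _, hB', fun v hs hκ i => ?_⟩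
    have hs' : ∀ i, ρ v ≠ s i := by
      intro i he
      by_cases hv : v ∈ M
      · exact (hnb i).1 (by rw [← he, hρM v hv])
      · exact hs i (by rw [← he, hρN v hv])
    have hκ' : ∀ i, ρ v ≠ κ i := by
      intro i he
      by_cases hv : v ∈ M
      · exact (hnb i).2 (by rw [← he, hρM v hv])
      · exact hκ i (by rw [← he, hρN v hv])
    have := hR (ρ v) hs' hκ' i
    rw [hadj v (s i) (by rw [hρid]; exact hs' i), hadj v (κ i) (by rw [hρid]; exact hκ' i), hρid,
      hρid]
    exact this

lemma induce_compl (G : SimpleGraph V) (W : Set V) : Gᶜ.induce W = (G.induce W)ᶜ := by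
  ext a b
  simp [Subtype.ext_iff]

lemma lift_decomposes (hG : G.P4Uniform) {M : Set V}
    (hM : ∀ x ∉ M, ∀ m ∈ M, ∀ m' ∈ M, G.Adj x m ↔ G.Adj x m') {b b' : V} (hb : b ∈ M)
    (hb' : b' ∈ M) (hne : b' ≠ b) (h : (G.induce (insert b Mᶜ)).Decomposes) : G.Decomposes := by
  rcases h with h | h
  · exact Or.inl (lift_decomposition hG hM hb hb' hne h)
  · rw [← induce_compl] at h
    refine Or.inr (lift_decomposition hG.compl (fun x hx m hm m' hm' => ?_) hb hb' hne h)
    have h1 : x ≠ m := fun e => hx (e ▸ hm)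
    have h2 : x ≠ m' := fun e => hx (e ▸ hm')
    simp [h1, h2, hM x hx m hm m' hm']

/-! ### The structure theorem -/

/-- Cograph step: if deleting `v` disconnects a `P₄`-free graph, the graph or its complement is
disconnected. -/
lemma splits_of_splits_delete (hP : ∀ a b c d, ¬ G.IsInducedP4 a b c d) (v : V) {U W : Set V}
    (hU : U.Nonempty) (hW : W.Nonempty) (hUW : ∀ x, x ≠ v ↔ x ∈ U ∨ x ∈ W)
    (hd : Disjoint U W) (hno : ∀ u ∈ U, ∀ w ∈ W, ¬ G.Adj u w) : G.Splits ∨ Gᶜ.Splits := by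
  by_cases hdom : ∀ y, y ≠ v → G.Adj v y
  · obtain ⟨u, hu⟩ := hU
    refine Or.inr ⟨{v}, ⟨v, rfl⟩, ⟨u, fun h => (hUW u).2 (Or.inl hu) h⟩, ?_⟩
    rintro _ rfl w hw h
    rw [compl_adj] at h
    exact h.2 (hdom w hw)
  push Not at hdom
  obtain ⟨y, hyv, hvy⟩ := hdom
  refine Or.inl ?_
  wlog hy : y ∈ U generalizing U W
  · exact this hW hU (fun x => by rw [hUW, or_comm]) hd.symm
      (fun u hu w hw h => hno w hw u hu h.symm) (((hUW y).1 hyv).resolve_left hy)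
  by_cases hz : ∃ z ∈ W, G.Adj v z
  swap
  · push Not at hz
    obtain ⟨w, hw⟩ := hW
    refine ⟨W, ⟨w, hw⟩, ⟨v, fun h => (hUW v).2 (Or.inr h) rfl⟩, fun x hx z hz' h => ?_⟩
    by_cases hzv : z = v
    · subst hzv; exact hz x hx h.symm
    · exact hno z (((hUW z).1 hzv).resolve_right hz') x hx h.symm
  obtain ⟨z, hzW, hvz⟩ := hz
  -- No edge `p q` leaves the set of non-neighbours of `v` in `U`: if `q` is a neighbour of `v`
  -- in `U`, then `p, q, v, z` is an induced path.
  refine ⟨{x ∈ U | ¬ G.Adj v x}, ⟨y, hy, hvy⟩,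
    ⟨z, fun h => Set.disjoint_left.1 hd h.1 hzW⟩, ?_⟩
  rintro p ⟨hpU, hvp⟩ q hq hpq
  by_cases hqv : q = v
  · subst hqv; exact hvp hpq.symm
  rcases (hUW q).1 hqv with hqU | hqW
  · have hvq : G.Adj v q := by
      by_contra hvq
      exact hq ⟨hqU, hvq⟩
    exact hP p q v z ⟨hpq, hvq.symm, hvz, fun h => hvp h.symm, hno q hqU z hzW, hno p hpU z hzW⟩
  · exact hno p hpU q hqW hpq

lemma Splits.exists_parts_of_induce {v : V} (h : (G.induce {v}ᶜ).Splits) :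
    ∃ U W : Set V, U.Nonempty ∧ W.Nonempty ∧ (∀ x, x ≠ v ↔ x ∈ U ∨ x ∈ W) ∧ Disjoint U W ∧
      ∀ u ∈ U, ∀ w ∈ W, ¬ G.Adj u w := by
  obtain ⟨U, hU, hW, hno⟩ := h
  refine ⟨Subtype.val '' U, Subtype.val '' Uᶜ, hU.image _, hW.image _, fun x => ?_, ?_, ?_⟩
  · constructor
    · intro hx
      by_cases hxU : (⟨x, hx⟩ : ({v}ᶜ : Set V)) ∈ U
      · exact Or.inl ⟨_, hxU, rfl⟩
      · exact Or.inr ⟨_, hxU, rfl⟩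
    · rintro (⟨y, -, rfl⟩ | ⟨y, -, rfl⟩) <;> exact y.2
  · exact (Set.disjoint_image_iff Subtype.val_injective).2 disjoint_compl_right
  · rintro _ ⟨u, hu, rfl⟩ _ ⟨w, hw, rfl⟩
    exact hno u hu w hw

lemma IsThinSpider.exists_isInducedP4 (h : G.IsThinSpider) :
    ∃ a b c d, G.IsInducedP4 a b c d := by
  obtain ⟨k, hk, s, κ, hB, -⟩ := h
  exact ⟨_, _, _, _, hB.isInducedP4 (i := ⟨0, by omega⟩) (j := ⟨1, by omega⟩) (by simp)⟩

/-- Inductive step of the theorem that a `P₄`-free graph on at least two vertices or its complement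
is disconnected. -/
lemma decomposes_of_p4Free (hP : ∀ a b c d, ¬ G.IsInducedP4 a b c d) [Nontrivial V]
    (ih : ∀ W : Set V, W ≠ Set.univ → W.Nontrivial → (G.induce W).Decomposes) :
    G.Decomposes := by
  obtain ⟨v, w, hvw⟩ := exists_pair_ne V
  have hPc : ∀ a b c d, ¬ Gᶜ.IsInducedP4 a b c d :=
    fun a b c d h => hP _ _ _ _ (isInducedP4_compl h)
  suffices h : G.Splits ∨ Gᶜ.Splits by
    rcases h with h | h
    · exact Or.inl (Or.inl h)
    · exact Or.inr (Or.inl h)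
  by_cases hnt : ({v}ᶜ : Set V).Nontrivial
  · have hd := ih {v}ᶜ (fun h => by have := h.ge (Set.mem_univ v); simp at this) hnt
    rw [Decomposes, ← induce_compl] at hd
    rcases hd with (h | h) | (h | h)
    · obtain ⟨U, W, hU, hW, hUW, hd, hno⟩ := h.exists_parts_of_induce
      exact splits_of_splits_delete hP v hU hW hUW hd hno
    · obtain ⟨a, b, c, d, h⟩ := h.exists_isInducedP4
      exact absurd h (hP a b c d)
    · obtain ⟨U, W, hU, hW, hUW, hd, hno⟩ := h.exists_parts_of_induce
      have := splits_of_splits_delete hPc v hU hW hUW hd hno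
      rwa [compl_compl, or_comm] at this
    · obtain ⟨a, b, c, d, h⟩ := h.exists_isInducedP4
      exact absurd h (hPc a b c d)
  · have hw : ∀ x, x ≠ v → x = w := fun x hx =>
      Set.not_nontrivial_iff.1 hnt hx (show w ∈ ({v}ᶜ : Set V) from hvw.symm)
    by_cases hadj : G.Adj v w
    · refine Or.inr ⟨{v}, ⟨v, rfl⟩, ⟨w, hvw.symm⟩, ?_⟩
      rintro _ rfl x hx h
      rw [hw x hx, compl_adj] at h
      exact h.2 hadj
    · refine Or.inl ⟨{v}, ⟨v, rfl⟩, ⟨w, hvw.symm⟩, ?_⟩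
      rintro _ rfl x hx h
      exact hadj (hw x hx ▸ h)

/-- The case of a graph containing a `P₄`: a thin body that is largest among those of `G` and `Gᶜ`,
together with the vertices seeing exactly its clique, is a module. If it is not everything, it is
shrunk to a vertex and the induction hypothesis applies. -/
lemma decomposes_of_maximal_body (hG : G.P4Uniform) {k : ℕ} (hk : 2 ≤ k) {s κ : Fin k → V}
    (hB : G.IsThinBody s κ)
    (hmax : ∀ s' κ' : Fin (k + 1) → V, ¬ G.IsThinBody s' κ' ∧ ¬ Gᶜ.IsThinBody s' κ')
    (ih : ∀ W : Set V, W ≠ Set.univ → W.Nontrivial → (G.induce W).Decomposes) :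
    G.Decomposes := by
  let i₀ : Fin k := ⟨0, by omega⟩
  let i₁ : Fin k := ⟨1, by omega⟩
  let Out : V → Prop := fun v => (∀ i, v ≠ s i) ∧ ∀ i, v ≠ κ i
  let M : Set V := {v | Out v → ¬ G.Adj v (s i₀) ∧ G.Adj v (κ i₀)}
  have hunif : ∀ v, Out v → ∀ i j, (G.Adj v (s i) ↔ G.Adj v (s j)) ∧
      (G.Adj v (κ i) ↔ G.Adj v (κ j)) ∧ (G.Adj v (s i) → G.Adj v (κ j)) :=
    fun v hv => hB.uniform hG hk hv.1 hv.2
  have hsM : ∀ i, s i ∈ M := fun i h => absurd rfl (h.1 i)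
  have hκM : ∀ i, κ i ∈ M := fun i h => absurd rfl (h.2 i)
  -- An edge from a vertex seeing nothing to a head vertex would be a further leg.
  have hnone : ∀ x y, Out x → ¬ G.Adj x (κ i₀) → Out y → ¬ G.Adj y (s i₀) → G.Adj y (κ i₀) →
      ¬ G.Adj x y := by
    intro x y hx hxκ hy hys hyκ hxy
    refine (hmax (Fin.cons x s) (Fin.cons y κ)).1 ⟨?_, ?_, ?_⟩
    · intro i j
      induction i using Fin.cases <;> induction j using Fin.cases <;>
        simp only [Fin.cons_zero, Fin.cons_succ]
      · exact G.irrefl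
      · exact fun h => hxκ ((hunif x hx _ _).2.2 h)
      · exact fun h => hxκ ((hunif x hx _ _).2.2 h.symm)
      · exact hB.1 _ _
    · intro i j hij
      induction i using Fin.cases <;> induction j using Fin.cases <;>
        simp only [Fin.cons_zero, Fin.cons_succ]
      · exact absurd rfl hij
      · exact (hunif y hy _ _).2.1.1 hyκ
      · exact ((hunif y hy _ _).2.1.1 hyκ).symm
      · exact hB.2.1 _ _ fun h => hij (by rw [h])
    · intro i j
      induction i using Fin.cases <;> induction j using Fin.cases <;>
        simp only [Fin.cons_zero, Fin.cons_succ]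
      · simpa using hxy
      · exact iff_of_false (fun h => hxκ ((hunif x hx _ _).2.1.1 h)) (Fin.succ_ne_zero _).symm
      · exact iff_of_false (fun h => hys ((hunif y hy _ _).1.1 h.symm)) (Fin.succ_ne_zero _)
      · rw [hB.2.2, Fin.succ_inj]
  have hall : ∀ x y, Out x → G.Adj x (s i₀) → Out y → ¬ G.Adj y (s i₀) → G.Adj y (κ i₀) →
      G.Adj x y := by
    intro x y hx hxs hy hys hyκ
    by_contra hxy
    have hx1 : ∀ i, G.Adj x (s i) := fun i => (hunif x hx _ _).1.1 hxs
    have hx2 : ∀ i, G.Adj x (κ i) := fun i => (hunif x hx _ _).2.2 hxs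
    have hy1 : ∀ i, ¬ G.Adj y (s i) := fun i h => hys ((hunif y hy _ _).1.1 h)
    have hy2 : ∀ i, G.Adj y (κ i) := fun i => (hunif y hy _ _).2.1.1 hyκ
    have hne : x ≠ y := by rintro rfl; exact hys hxs
    have h01 : i₀ ≠ i₁ := by simp [i₀, i₁]
    have hp := hB.isInducedP4 h01
    rcases hk.eq_or_lt with rfl | hk3
    · -- With two legs, the nonadjacent pair turns the `P₄` into a thick body with three legs.
      refine (hmax ![κ i₁, κ i₀, x] ![s i₀, s i₁, y]).2 ?_
      have hpn := hp.ne
      have q1 := hx.1 i₀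
      have q2 := hx.1 i₁
      have q3 := hx.2 i₀
      have q4 := hx.2 i₁
      have r1 := hy.1 i₀
      have r2 := hy.1 i₁
      have r3 := hy.2 i₀
      have r4 := hy.2 i₁
      have a1 := hx1 i₀
      have a2 := hx1 i₁
      have a3 := hx2 i₀
      have a4 := hx2 i₁
      have b1 := hy1 i₀
      have b2 := hy1 i₁
      have b3 := hy2 i₀
      have b4 := hy2 i₁
      obtain ⟨p1, p2, p3, p4, p5, p6⟩ := hp
      refine ⟨?_, ?_, ?_⟩
      · simp [Fin.forall_fin_succ, compl_adj]
        grind [G.adj_comm]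
      · simp [Fin.forall_fin_succ, compl_adj]
        grind [G.adj_comm]
      · simp [Fin.forall_fin_succ, compl_adj]
        grind [G.adj_comm]
    · -- A third leg sees `x` but nothing else on the path `y, κ i₀, x, s i₁`.
      let i₂ : Fin k := ⟨2, hk3⟩
      have h02 : i₂ ≠ i₀ := by simp [i₀, i₂]
      have h12 : i₂ ≠ i₁ := by simp [i₁, i₂]
      have hP : G.IsInducedP4 y (κ i₀) x (s i₁) := by
        refine ⟨hy2 _, (hx2 _).symm, hx1 _, fun h => hxy h.symm, ?_, hy1 _⟩
        rw [adj_comm, hB.2.2]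
        exact h01.symm
      have := hG _ _ _ _ (s i₂) hP (hy.1 _).symm (hB.leg_ne_body _ _) (hx.1 _).symm
        (fun h => h12 (hB.injective_legs h))
      exact h02 ((hB.2.2 _ _).1 (this.2.1.2 (hx1 _).symm))
  by_cases hM : ∃ x, x ∉ M
  · obtain ⟨x, hx⟩ := hM
    refine lift_decomposes hG (M := M) ?_ (hsM i₀) (hκM i₀) (hB.leg_ne_body _ _).symm
      (ih _ ?_ ⟨s i₀, Set.mem_insert _ _, x, Set.mem_insert_of_mem _ hx, fun h => hx (h ▸ hsM _)⟩)
    · intro x hx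
      have hxO : Out x := by
        by_contra h
        exact hx fun h' => absurd h' h
      suffices h : (∀ m ∈ M, G.Adj x m) ∨ ∀ m ∈ M, ¬ G.Adj x m by
        intro m hm m' hm'
        rcases h with h | h
        · exact iff_of_true (h m hm) (h m' hm')
        · exact iff_of_false (h m hm) (h m' hm')
      by_cases hxs : G.Adj x (s i₀)
      · refine Or.inl fun m hm => ?_
        by_cases hmO : Out m
        · exact hall x m hxO hxs hmO (hm hmO).1 (hm hmO).2
        · simp only [Out, not_and_or, not_forall, not_not] at hmO
          rcases hmO with ⟨i, rfl⟩ | ⟨i, rfl⟩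
          · exact (hunif x hxO _ _).1.1 hxs
          · exact (hunif x hxO _ _).2.2 hxs
      · have hxκ : ¬ G.Adj x (κ i₀) := fun h => hx fun _ => ⟨hxs, h⟩
        refine Or.inr fun m hm => ?_
        by_cases hmO : Out m
        · exact hnone x m hxO hxκ hmO (hm hmO).1 (hm hmO).2
        · simp only [Out, not_and_or, not_forall, not_not] at hmO
          rcases hmO with ⟨i, rfl⟩ | ⟨i, rfl⟩
          · exact fun h => hxs ((hunif x hxO _ _).1.1 h)
          · exact fun h => hxκ ((hunif x hxO _ _).2.1.1 h)
    · intro h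
      rcases h.ge (Set.mem_univ (κ i₀)) with h | h
      · exact hB.leg_ne_body _ _ h.symm
      · exact h (hκM _)
  · push Not at hM
    refine Or.inl (Or.inr ⟨k, hk, s, κ, hB, fun v hs hκ i => ?_⟩)
    have := hM v ⟨hs, hκ⟩
    have hu := hunif v ⟨hs, hκ⟩ i i₀
    exact ⟨fun h => this.1 (hu.1.1 h), hu.2.1.2 this.2⟩

/-- The structure theorem of Jamison and Olariu: a `P₄`-sparse graph with at least two vertices is
disconnected, a thin spider, or the complement of such a graph. -/
theorem P4Uniform.decomposes {V : Type u} [Finite V] [Nontrivial V] {G : SimpleGraph V}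
    (hG : G.P4Uniform) : G.Decomposes := by
  induction hn : Nat.card V using Nat.strong_induction_on generalizing V with
  | _ n IH =>
  have ih : ∀ H : SimpleGraph V, H.P4Uniform → ∀ W : Set V, W ≠ Set.univ → W.Nontrivial →
      (H.induce W).Decomposes := by
    intro H hH W hW hW2
    have : Nontrivial W := hW2.coe_sort
    refine IH _ ?_ (hH.induce W) rfl
    rw [← hn, Nat.card_coe_set_eq]
    exact Set.ncard_lt_card hW
  by_cases hP : ∀ a b c d, ¬ G.IsInducedP4 a b c d
  · exact decomposes_of_p4Free hP (ih G hG)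
  push Not at hP
  obtain ⟨a, b, c, d, hp⟩ := hP
  classical
  let Q : ℕ → Prop := fun k => ∃ s κ : Fin k → V, G.IsThinBody s κ ∨ Gᶜ.IsThinBody s κ
  have hQ2 : Q 2 := by
    refine ⟨![a, d], ![b, c], Or.inl ?_⟩
    obtain ⟨p1, p2, p3, p4, p5, p6⟩ := hp
    refine ⟨?_, ?_, ?_⟩ <;> simp [Fin.forall_fin_succ] <;> grind [G.adj_comm]
  have hQle : ∀ k, Q k → k ≤ Nat.card V := by
    rintro k ⟨s, κ, h | h⟩ <;>
    simpa using Nat.card_le_card_of_injective _ h.injective_legs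
  have hk := Nat.le_findGreatest (hQle 2 hQ2) hQ2
  obtain ⟨s, κ, hB⟩ := Nat.findGreatest_spec (hQle 2 hQ2) hQ2
  have hmax : ¬ Q (Nat.findGreatest Q (Nat.card V) + 1) := fun h =>
    absurd (Nat.le_findGreatest (hQle _ h) h) (by omega)
  simp only [Q, not_exists, not_or] at hmax
  rcases hB with hB | hB
  · exact decomposes_of_maximal_body hG hk hB hmax (ih G hG)
  · refine Decomposes.of_compl (decomposes_of_maximal_body hG.compl hk hB ?_ (ih Gᶜ hG.compl))
    simpa only [compl_compl, and_comm] using hmax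

end SimpleGraph

/-! ### Embedding decomposed graphs -/

namespace SimpleGraph

variable {V V' : Type*} {G : SimpleGraph V} {G' : SimpleGraph V'}

/-- The vertices outside the body of a spider. -/
def head {k : ℕ} (s κ : Fin k → V) : Set V := {v | (∀ i, v ≠ s i) ∧ ∀ i, v ≠ κ i}

/-- `A` and `B` are the parts left by a decomposition of `G`. If `spider` is false, they are the two
sides of a partition without crossing edges and `k` is irrelevant; if it is true, `G` is a thin
spider with `k` legs and both `A` and `B` are its head. -/
def DecomposesInto (G : SimpleGraph V) (spider : Bool) (k : ℕ) (A B : Set V) : Prop :=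
  match spider with
  | false => B = Aᶜ ∧ ∀ u ∈ A, ∀ w ∉ A, ¬ G.Adj u w
  | true => B = A ∧ ∃ s κ : Fin k → V, G.IsThinBody s κ ∧ A = head s κ ∧
      ∀ v ∈ A, ∀ i, ¬ G.Adj v (s i) ∧ G.Adj v (κ i)

lemma exists_decomposesInto (h : G.Splits ∨ G.IsThinSpider) :
    ∃ t k A B, G.DecomposesInto t k A B ∧ A ≠ Set.univ ∧ B ≠ Set.univ := by
  rcases h with ⟨U, hU, hW, h⟩ | ⟨k, hk, s, κ, hB, hR⟩
  · exact ⟨false, 0, U, Uᶜ, ⟨rfl, h⟩, by simpa [Set.nonempty_compl] using hW,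
      by simpa [Set.nonempty_iff_ne_empty] using hU⟩
  · have hne : head s κ ≠ Set.univ := fun h =>
      (h.ge (Set.mem_univ (s ⟨0, by omega⟩))).1 _ rfl
    exact ⟨true, k, _, _, ⟨rfl, s, κ, hB, rfl, fun v hv => hR v hv.1 hv.2⟩, hne, hne⟩

lemma isIndContained_of_parts {A : Set V} {A' : Set V'}
    (h : ∀ u ∈ A, ∀ w ∉ A, ¬ G.Adj u w) (h' : ∀ u ∈ A', ∀ w ∉ A', ¬ G'.Adj u w)
    (hA : (G.induce A).IsIndContained (G'.induce A'))
    (hB : (G.induce Aᶜ).IsIndContained (G'.induce A'ᶜ)) : G.IsIndContained G' := by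
  classical
  obtain ⟨e⟩ := hA
  obtain ⟨e'⟩ := hB
  let f : V → V' := fun v => if hv : v ∈ A then e ⟨v, hv⟩ else e' ⟨v, hv⟩
  have hf : ∀ v (hv : v ∈ A), f v = e ⟨v, hv⟩ := fun v hv => by simp [f, hv]
  have hf' : ∀ v (hv : v ∉ A), f v = e' ⟨v, hv⟩ := fun v hv => by simp [f, hv]
  have hmem : ∀ v, f v ∈ A' ↔ v ∈ A := by
    intro v
    by_cases hv : v ∈ A
    · rw [hf v hv]; exact iff_of_true (e _).2 hv
    · rw [hf' v hv]; exact iff_of_false (e' _).2 hv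
  refine ⟨⟨⟨f, fun v w hvw => ?_⟩, fun {v w} => ?_⟩⟩
  · have hm := hmem v
    rw [hvw, hmem] at hm
    by_cases hv : v ∈ A
    · rw [hf v hv, hf w (hm.2 hv)] at hvw
      exact congrArg Subtype.val (e.injective (Subtype.ext hvw))
    · rw [hf' v hv, hf' w (fun h => hv (hm.1 h))] at hvw
      exact congrArg Subtype.val (e'.injective (Subtype.ext hvw))
  · change G'.Adj (f v) (f w) ↔ G.Adj v w
    by_cases hv : v ∈ A <;> by_cases hw : w ∈ A
    · rw [hf v hv, hf w hw]
      exact e.map_adj_iff (v := ⟨v, hv⟩) (w := ⟨w, hw⟩)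
    · exact iff_of_false (h' _ ((hmem v).2 hv) _ (fun h => hw ((hmem w).1 h))) (h _ hv _ hw)
    · exact iff_of_false (fun ha => h' _ ((hmem w).2 hw) _ (fun h => hv ((hmem v).1 h)) ha.symm)
        (fun ha => h _ hw _ hv ha.symm)
    · rw [hf' v hv, hf' w hw]
      exact e'.map_adj_iff (v := ⟨v, hv⟩) (w := ⟨w, hw⟩)

lemma IsThinBody.bijective {k : ℕ} {s κ : Fin k → V} (h : G.IsThinBody s κ) :
    Function.Bijective (Sum.elim (Sum.elim s κ) (Subtype.val : head s κ → V)) := by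
  constructor
  · refine Function.Injective.sumElim (h.injective_legs.sumElim h.injective_body h.leg_ne_body)
      Subtype.val_injective ?_
    rintro (i | i) ⟨v, hv⟩ he
    · exact hv.1 i he.symm
    · exact hv.2 i he.symm
  · intro v
    by_cases hv : v ∈ head s κ
    · exact ⟨Sum.inr ⟨v, hv⟩, rfl⟩
    · simp only [head, Set.mem_ofPred_eq, not_and_or, not_forall, not_not] at hv
      rcases hv with ⟨i, rfl⟩ | ⟨i, rfl⟩
      · exact ⟨Sum.inl (Sum.inl i), rfl⟩
      · exact ⟨Sum.inl (Sum.inr i), rfl⟩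

lemma isIndContained_of_spiders {k k' : ℕ} (hk : k ≤ k') {s κ : Fin k → V} {s' κ' : Fin k' → V'}
    (hB : G.IsThinBody s κ) (hB' : G'.IsThinBody s' κ')
    (hR : ∀ v ∈ head s κ, ∀ i, ¬ G.Adj v (s i) ∧ G.Adj v (κ i))
    (hR' : ∀ v ∈ head s' κ', ∀ i, ¬ G'.Adj v (s' i) ∧ G'.Adj v (κ' i))
    (h : (G.induce (head s κ)).IsIndContained (G'.induce (head s' κ'))) :
    G.IsIndContained G' := by
  obtain ⟨e⟩ := h
  let p := Equiv.ofBijective _ hB.bijective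
  let p' := Equiv.ofBijective _ hB'.bijective
  let c : Fin k ↪ Fin k' := (Fin.castLEEmb hk)
  let g := Sum.map (Sum.map c c) e
  have hg : Function.Injective g := (c.injective.sumMap c.injective).sumMap e.injective
  refine ⟨⟨⟨fun v => p' (g (p.symm v)),
    p'.injective.comp (hg.comp p.symm.injective)⟩, fun {v w} => ?_⟩⟩
  obtain ⟨x, rfl⟩ := p.surjective v
  obtain ⟨y, rfl⟩ := p.surjective w
  simp only [Function.Embedding.coeFn_mk, Equiv.symm_apply_apply]
  rcases x with (i | i) | v <;> rcases y with (j | j) | w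
  · exact iff_of_false (hB'.1 _ _) (hB.1 _ _)
  · exact (hB'.2.2 _ _).trans (c.injective.eq_iff.trans (hB.2.2 _ _).symm)
  · exact iff_of_false (fun h => (hR' _ (e w).2 _).1 h.symm) (fun h => (hR _ w.2 _).1 h.symm)
  · rw [adj_comm, G.adj_comm]
    exact (hB'.2.2 _ _).trans (c.injective.eq_iff.trans (hB.2.2 _ _).symm)
  · change G'.Adj (κ' (c i)) (κ' (c j)) ↔ G.Adj (κ i) (κ j)
    by_cases hij : i = j
    · subst hij
      exact iff_of_false G'.irrefl G.irrefl
    · exact iff_of_true (hB'.2.1 _ _ (c.injective.ne hij)) (hB.2.1 _ _ hij)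
  · exact iff_of_true (hR' _ (e w).2 _).2.symm (hR _ w.2 _).2.symm
  · exact iff_of_false (hR' _ (e v).2 _).1 (hR _ v.2 _).1
  · exact iff_of_true (hR' _ (e v).2 _).2 (hR _ v.2 _).2
  · exact e.map_adj_iff

lemma DecomposesInto.isIndContained {t : Bool} {k k' : ℕ} {A B : Set V} {A' B' : Set V'}
    (h : G.DecomposesInto t k A B) (h' : G'.DecomposesInto t k' A' B') (hk : k ≤ k')
    (hA : (G.induce A).IsIndContained (G'.induce A'))
    (hB : (G.induce B).IsIndContained (G'.induce B')) : G.IsIndContained G' := by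
  cases t with
  | false =>
    obtain ⟨rfl, h⟩ := h
    obtain ⟨rfl, h'⟩ := h'
    exact isIndContained_of_parts h h' hA hB
  | true =>
    obtain ⟨rfl, s, κ, hb, rfl, hR⟩ := h
    obtain ⟨rfl, s', κ', hb', rfl, hR'⟩ := h'
    exact isIndContained_of_spiders hk hb hb' hR hR' hA

/-- `G`, or its complement if `co` is true, decomposes into the parts `A` and `B`. -/
def CoDecomposesInto (G : SimpleGraph V) (co spider : Bool) (k : ℕ) (A B : Set V) : Prop :=
  (bif co then Gᶜ else G).DecomposesInto spider k A B

lemma CoDecomposesInto.isIndContained {co t : Bool} {k k' : ℕ} {A B : Set V} {A' B' : Set V'}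
    (h : G.CoDecomposesInto co t k A B) (h' : G'.CoDecomposesInto co t k' A' B') (hk : k ≤ k')
    (hA : (G.induce A).IsIndContained (G'.induce A'))
    (hB : (G.induce B).IsIndContained (G'.induce B')) : G.IsIndContained G' := by
  cases co with
  | false => exact DecomposesInto.isIndContained h h' hk hA hB
  | true =>
    refine .of_compl (DecomposesInto.isIndContained h h' hk ?_ ?_) <;>
    · rw [induce_compl, induce_compl]
      exact .compl ‹_›

lemma Decomposes.exists_coDecomposesInto (h : G.Decomposes) :
    ∃ co t k A B, G.CoDecomposesInto co t k A B ∧ A ≠ Set.univ ∧ B ≠ Set.univ := by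
  rcases h with h | h
  · exact ⟨false, exists_decomposesInto h⟩
  · exact ⟨true, exists_decomposesInto h⟩

end SimpleGraph

/-! ### `P₄`-sparse graphs -/

namespace FiniteGraph

instance : IsPreorder FiniteGraph.{u} IndLE where
  refl G := .refl G.graph
  trans _ _ _ h h' := h.trans h'

lemma induce_indLE (G : FiniteGraph.{u}) (s : Set G.V) : (G.induce s).IndLE G :=
  ⟨SimpleGraph.Embedding.induce s⟩

lemma IndLE.card_le {G H : FiniteGraph.{u}} (h : H.IndLE G) : Nat.card H.V ≤ Nat.card G.V := by
  obtain ⟨e⟩ := h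
  have := G.finite
  exact Nat.card_le_card_of_injective e e.injective

lemma card_induce_lt (G : FiniteGraph.{u}) {s : Set G.V} (hs : s ≠ Set.univ) :
    Nat.card (G.induce s).V < Nat.card G.V := by
  have := G.finite
  change Nat.card s < _
  rw [Nat.card_coe_set_eq]
  exact Set.ncard_lt_card hs

lemma inducesP4_iff {G : FiniteGraph.{u}} {X : Finset G.V} :
    G.InducesP4 X ↔ ∃ f : SimpleGraph.pathGraph 4 ↪g G.graph, Set.range f = X := by
  constructor
  · rintro ⟨e⟩
    refine ⟨(SimpleGraph.Embedding.induce _).comp e.toEmbedding, ?_⟩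
    ext v
    constructor
    · rintro ⟨i, rfl⟩
      exact (e i).2
    · intro hv
      exact ⟨e.symm ⟨v, hv⟩, by simp⟩
  · rintro ⟨f, hf⟩
    refine ⟨⟨Equiv.ofBijective (fun i => ⟨f i, hf ▸ Set.mem_range_self i⟩) ⟨?_, ?_⟩, ?_⟩⟩
    · intro i j hij
      exact f.injective (congrArg Subtype.val hij)
    · rintro ⟨v, hv⟩
      rw [← hf] at hv
      obtain ⟨i, rfl⟩ := hv
      exact ⟨i, rfl⟩
    · intro i j
      exact f.map_adj_iff

lemma IsP4Sparse.of_indLE {G H : FiniteGraph.{u}} (hG : G.IsP4Sparse) (h : H.IndLE G) :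
    H.IsP4Sparse := by
  obtain ⟨e⟩ := h
  have hmap : ∀ X : Finset H.V, H.InducesP4 X → G.InducesP4 (X.map e.toEmbedding) := by
    intro X hX
    obtain ⟨f, hf⟩ := inducesP4_iff.1 hX
    refine inducesP4_iff.2 ⟨e.comp f, ?_⟩
    rw [Finset.coe_map, ← hf, ← Set.range_comp]
    rfl
  intro W hW X Y hX hY hX4 hY4
  have := hG (W.map e.toEmbedding) (by rwa [Finset.card_map]) _ _ (Finset.map_subset_map.2 hX)
    (Finset.map_subset_map.2 hY) (hmap X hX4) (hmap Y hY4)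
  exact Finset.map_injective _ this

open Classical in
lemma inducesP4_of_isInducedP4 {G : FiniteGraph.{u}} {a b c d : G.V}
    (h : G.graph.IsInducedP4 a b c d) : G.InducesP4 {a, b, c, d} := by
  have hn := h.ne
  obtain ⟨h1, h2, h3, h4, h5, h6⟩ := h
  refine inducesP4_iff.2 ⟨⟨⟨![a, b, c, d], ?_⟩, ?_⟩, ?_⟩
  · simp only [Function.Injective, Fin.forall_fin_succ]
    simp
    grind
  · intro i j
    revert i j
    simp only [SimpleGraph.pathGraph_adj, Fin.forall_fin_succ]
    simp
    grind [G.graph.adj_comm]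
  · ext v
    simp [eq_comm]
    tauto

open Classical in
/-- A `P₄` inside `{a, b, c, d, x}` other than `a, b, c, d` has to pass through `x`. -/
lemma IsP4Sparse.not_isInducedP4 {G : FiniteGraph.{u}} (hG : G.IsP4Sparse) {a b c d x : G.V}
    (hp : G.graph.IsInducedP4 a b c d) (ha : x ≠ a) (hb : x ≠ b) (hc : x ≠ c) (hd : x ≠ d)
    {p q r t : G.V} (hsub : ({p, q, r, t} : Finset G.V) ⊆ {a, b, c, d, x})
    (hx : x ∈ ({p, q, r, t} : Finset G.V)) : ¬ G.graph.IsInducedP4 p q r t := by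
  intro h
  have := hG {a, b, c, d, x} Finset.card_le_five {a, b, c, d} {p, q, r, t}
    (by intro v; simp; tauto) hsub (inducesP4_of_isInducedP4 hp) (inducesP4_of_isInducedP4 h)
  rw [← this] at hx
  simp [ha, hb, hc, hd] at hx

/-- Adjacency patterns of `x` that create a second `P₄`, up to reversing the path. -/
lemma IsP4Sparse.forbidden_patterns {G : FiniteGraph.{u}} (hG : G.IsP4Sparse) {a b c d x : G.V}
    (hp : G.graph.IsInducedP4 a b c d) (ha : x ≠ a) (hb : x ≠ b) (hc : x ≠ c) (hd : x ≠ d) :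
    (G.graph.Adj x a → G.graph.Adj x b ∨ G.graph.Adj x c) ∧
      (G.graph.Adj x b → G.graph.Adj x c ∨ G.graph.Adj x d) ∧
      (G.graph.Adj x a → G.graph.Adj x c → G.graph.Adj x d) ∧
      (G.graph.Adj x a → G.graph.Adj x d → G.graph.Adj x c) := by
  have key := fun p q r t => hG.not_isInducedP4 hp ha hb hc hd (p := p) (q := q) (r := r) (t := t)
  obtain ⟨h1, h2, h3, h4, h5, h6⟩ := hp
  refine ⟨fun e1 => ?_, fun e1 => ?_, fun e1 e2 => ?_, fun e1 e2 => ?_⟩ <;> by_contra hno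
  · rw [not_or] at hno
    exact key x a b c (by intro v; simp; tauto) (by simp) ⟨e1, h1, h2, hno.1, h4, hno.2⟩
  · rw [not_or] at hno
    exact key x b c d (by intro v; simp; tauto) (by simp) ⟨e1, h2, h3, hno.1, h5, hno.2⟩
  · exact key a x c d (by intro v; simp; tauto) (by simp) ⟨e1.symm, e2, h3, h4, hno, h6⟩
  · exact key a x d c (by intro v; simp; tauto) (by simp) ⟨e1.symm, e2, h3.symm, h6, hno, h4⟩

lemma IsP4Sparse.p4Uniform {G : FiniteGraph.{u}} (hG : G.IsP4Sparse) : G.graph.P4Uniform := by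
  intro a b c d x hp ha hb hc hd
  obtain ⟨h1, h2, h3, h4⟩ := hG.forbidden_patterns hp ha hb hc hd
  obtain ⟨k1, k2, k3, k4⟩ := hG.forbidden_patterns hp.reverse hd hc hb ha
  exact ⟨⟨by grind, by grind⟩, ⟨by grind, by grind⟩, by grind⟩

/-! ### Well-quasi-ordering -/

/-- The proper induced subgraphs of the terms of a minimal bad sequence are well-quasi-ordered:
a bad sequence among them, spliced into the minimal one at the smallest index it touches, would
contradict minimality. -/
lemma wellQuasiOrdered_properParts {C : Set FiniteGraph.{u}}
    (hC : ∀ G ∈ C, ∀ H : FiniteGraph.{u}, H.IndLE G → H ∈ C) {f : ℕ → FiniteGraph.{u}}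
    (hf : Set.PartiallyWellOrderedOn.IsBadSeq IndLE C f)
    (hmin : ∀ n, Set.PartiallyWellOrderedOn.IsMinBadSeq IndLE (fun G => Nat.card G.V) C n f) :
    WellQuasiOrdered (fun G H : {H : FiniteGraph.{u} //
      ∃ n, H.IndLE (f n) ∧ Nat.card H.V < Nat.card (f n).V} => G.1.IndLE H.1) := by
  classical
  intro g
  by_contra! hg
  choose N hN hlt using fun i => (g i).2
  obtain ⟨i₀, hi₀⟩ : ∃ i₀, ∀ i, N i₀ ≤ N i := by
    obtain ⟨_, ⟨i₀, rfl⟩, h⟩ := Nat.lt_wfRel.wf.has_min (Set.range N) ⟨_, 0, rfl⟩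
    exact ⟨i₀, fun i => not_lt.1 (h _ ⟨i, rfl⟩)⟩
  refine hmin (N i₀) (fun m => if m < N i₀ then f m else (g (i₀ + (m - N i₀))).1)
    (fun m hm => (if_pos hm).symm) (by simpa using hlt i₀) ⟨fun m => ?_, fun m n hmn => ?_⟩
  · dsimp only
    split_ifs
    · exact hf.1 m
    · exact hC _ (hf.1 _) _ (hN _)
  · dsimp only
    split_ifs with h1 h2 h2
    · exact hf.2 m n hmn
    · exact fun h => hf.2 m (N (i₀ + (n - N i₀))) (h1.trans_le (hi₀ _)) (h.trans (hN _))
    · omega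
    · exact hg _ _ (by omega)

/-- Nash-Williams' minimal bad sequence argument, for the decomposition into two parts given by the
structure theorem. -/
theorem wellQuasiOrdered_isP4Sparse :
    WellQuasiOrdered
      (fun G H : {G : FiniteGraph.{u} // G.IsP4Sparse} => G.1.IndLE H.1) := by
  change {G : FiniteGraph.{u} | G.IsP4Sparse}.PartiallyWellOrderedOn IndLE
  rw [Set.PartiallyWellOrderedOn.iff_not_exists_isMinBadSeq (fun G => Nat.card G.V)]
  rintro ⟨f, hf, hmin⟩
  have hparts := wellQuasiOrdered_properParts (fun G hG H hH => IsP4Sparse.of_indLE hG hH) hf hmin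
  have hne : ∀ n, Nonempty (f n).V := by
    intro n
    by_contra h
    rw [not_nonempty_iff] at h
    exact hf.2 n (n + 1) n.lt_succ_self (.of_isEmpty)
  have hnt : ∀ n, Nontrivial (f n).V := by
    intro n
    by_contra h
    rw [not_nontrivial_iff_subsingleton] at h
    obtain ⟨v⟩ := hne (n + 1)
    refine hf.2 n (n + 1) n.lt_succ_self ⟨⟨⟨fun _ => v, fun a b _ => Subsingleton.elim a b⟩, ?_⟩⟩
    intro a b
    rw [Subsingleton.elim a b]
    simp
  have hdec : ∀ n, ∃ co t k A B, (f n).graph.CoDecomposesInto co t k A B ∧ A ≠ Set.univ ∧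
      B ≠ Set.univ := by
    intro n
    have := (f n).finite
    have := hnt n
    exact (IsP4Sparse.p4Uniform (hf.1 n)).decomposes.exists_coDecomposesInto
  choose co t k A B hd hA hB using hdec
  let T := {H : FiniteGraph.{u} // ∃ n, H.IndLE (f n) ∧ Nat.card H.V < Nat.card (f n).V}
  have : IsPreorder T (fun G H => G.1.IndLE H.1) :=
    { refl := fun G => .refl _, trans := fun _ _ _ h h' => h.trans h' }
  have : IsPreorder (Bool × Bool) (· = ·) := { refl := fun _ => rfl, trans := fun _ _ _ => Eq.trans }
  let part : ∀ n, ∀ s : Set (f n).V, s ≠ Set.univ → T := fun n s hs =>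
    ⟨(f n).induce s, n, (f n).induce_indLE s, (f n).card_induce_lt hs⟩
  obtain ⟨m, n, hmn, hct, hk, hpA, hpB⟩ :=
    ((Finite.wellQuasiOrdered (α := Bool × Bool) (· = ·)).prod
      ((wellQuasiOrdered_le (α := ℕ)).prod (hparts.prod hparts)))
    fun n => ((co n, t n), k n, part n (A n) (hA n), part n (B n) (hB n))
  obtain ⟨hco, ht⟩ := Prod.mk.inj hct
  have hdm := hd m
  rw [hco, ht] at hdm
  exact hf.2 m n hmn (hdm.isIndContained (hd n) hk hpA hpB)

/-! ### Minimal obstructions -/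

/-- An induced subgraph of a minimal obstruction that lacks the property is the whole obstruction. -/
lemma IsMinimalObstruction.isIso_of_indLE {P : FiniteGraph.{u} → Prop}
    (hP : IsHereditaryOn IsP4Sparse P) {G H : FiniteGraph.{u}} (hG : G.IsP4Sparse)
    (hGm : IsMinimalObstruction P G) (hH : ¬ P H) (h : H.IndLE G) : H.IsIso G := by
  have hHs := hG.of_indLE h
  obtain ⟨e⟩ := h
  by_cases hr : Set.range e = Set.univ
  · exact ⟨⟨Equiv.ofBijective e ⟨e.injective, Set.range_eq_univ.1 hr⟩, e.map_adj_iff⟩⟩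
  · refine absurd (hP _ _ (hG.of_indLE (G.induce_indLE _)) hHs ?_ (hGm.2 _ hr)) hH
    exact ⟨⟨⟨fun v => ⟨e v, v, rfl⟩, fun v w h => e.injective (congrArg Subtype.val h)⟩,
      e.map_adj_iff⟩⟩

lemma exists_isMinimalObstruction {P : FiniteGraph.{u} → Prop}
    {G : FiniteGraph.{u}} (h : ¬ P G) :
    ∃ H : FiniteGraph.{u}, H.IndLE G ∧ IsMinimalObstruction P H := by
  induction hn : Nat.card G.V using Nat.strong_induction_on generalizing G with
  | _ n ih =>
  by_cases hm : ∀ s : Set G.V, s ≠ Set.univ → P (G.induce s)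
  · exact ⟨G, .refl _, h, hm⟩
  · push Not at hm
    obtain ⟨s, hs, hPs⟩ := hm
    obtain ⟨H, hH, hHm⟩ := ih _ (hn ▸ G.card_induce_lt hs) hPs rfl
    exact ⟨H, hH.trans (G.induce_indLE s), hHm⟩

end FiniteGraph

theorem mainTheorem1 :
    -- The class of `P₄`-sparse graphs is well-quasi-ordered by the induced subgraph relation.
    WellQuasiOrdered
      (fun G H : {G : FiniteGraph.{u} // G.IsP4Sparse} => G.1.IndLE H.1) ∧
    -- Every hereditary property on `P₄`-sparse graphs has, up to isomorphism, finitely many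
    -- `P₄`-sparse minimal obstructions, and is characterized by forbidding them.
    ∀ P : FiniteGraph.{u} → Prop, FiniteGraph.IsHereditaryOn FiniteGraph.IsP4Sparse P →
      ∃ F : Set FiniteGraph.{u}, F.Finite ∧
        (∀ M ∈ F, M.IsP4Sparse ∧ FiniteGraph.IsMinimalObstruction P M) ∧
        (∀ G : FiniteGraph.{u}, G.IsP4Sparse → FiniteGraph.IsMinimalObstruction P G →
          ∃ M ∈ F, G.IsIso M) ∧
        (∀ G : FiniteGraph.{u}, G.IsP4Sparse → (P G ↔ ∀ M ∈ F, ¬ M.IndLE G)) := by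
  refine ⟨FiniteGraph.wellQuasiOrdered_isP4Sparse, fun P hP => ?_⟩
  let iso : Setoid FiniteGraph.{u} :=
    ⟨FiniteGraph.IsIso, fun G => ⟨.refl⟩, fun ⟨e⟩ => ⟨e.symm⟩, fun ⟨e⟩ ⟨e'⟩ => ⟨e'.comp e⟩⟩
  -- `F` consists of one minimal obstruction from each isomorphism class.
  obtain ⟨F, hFsub, hF⟩ := Set.exists_subset_bijOn
    {M : FiniteGraph.{u} | M.IsP4Sparse ∧ FiniteGraph.IsMinimalObstruction P M} (Quotient.mk iso)
  have hrep : ∀ G : FiniteGraph.{u}, G.IsP4Sparse → FiniteGraph.IsMinimalObstruction P G →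
      ∃ M ∈ F, G.IsIso M := by
    intro G hG hGm
    obtain ⟨M, hM, he⟩ := hF.surjOn ⟨G, ⟨hG, hGm⟩, rfl⟩
    exact ⟨M, hM, Quotient.exact he.symm⟩
  refine ⟨F, ?_, fun M hM => hFsub hM, hrep, fun G hG => ⟨fun hPG M hM hMG => ?_, fun h => ?_⟩⟩
  -- Comparable members of `F` are isomorphic, hence equal.
  · by_contra hinf
    let φ := Set.Infinite.natEmbedding F hinf
    obtain ⟨m, n, hmn, hle⟩ := FiniteGraph.wellQuasiOrdered_isP4Sparse.{u}
      fun n => ⟨(φ n).1, (hFsub (φ n).2).1⟩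
    have hi := (hFsub (φ n).2).2.isIso_of_indLE hP (hFsub (φ n).2).1 (hFsub (φ m).2).2.1 hle
    exact hmn.ne (φ.injective (Subtype.ext (hF.injOn (φ m).2 (φ n).2 (Quotient.sound hi))))
  · exact (hFsub hM).2.1 (hP G M hG (hFsub hM).1 hMG hPG)
  · by_contra hPG
    obtain ⟨H, hHG, hH⟩ := FiniteGraph.exists_isMinimalObstruction hPG
    obtain ⟨M, hM, ⟨e⟩⟩ := hrep H (hG.of_indLE hHG) hH
    exact h M hM (SimpleGraph.IsIndContained.trans ⟨e.symm.toEmbedding⟩ hHG)
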